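/- Let $\overline{\mathbb Q}$ be the field of algebraic numbers (the algebraic closure of $\mathbb Q$ in $\mathbb C$) and let $H$ be the absolute multiplicative (non-logarithmic) Weil height on $\overline{\mathbb Q}$. A subset $\mathcal A\subseteq\overline{\mathbb Q}$ has property $(N)$ if for each real $X>0$ there are only finitely many $\alpha\in\mathcal A$ with $H(\alpha)\le X$. **Theorem.** Property $(N)$ is not generally preserved under taking the compositum of two subfields of $\overline{\mathbb Q}$. More concretely: for $i=1,2,3,\dots$ let $p_i$ be the $(i+1)$-th prime number (so $p_1=3$, $p_2=5$, $\dots$) and set $d_i=\lfloor\sqrt{\log p_i}\rfloor$, which is a positive integer. For positive integers $a,b$ let $a^{1/b}$ denote the positive real $b$-th root of $a$. Let $$L_1=\mathbb Q\bigl(p_1^{1/d_1},p_2^{1/d_2},p_3^{1/d_3},\dots\bigr),\qquad L_2=\mathbb Q\bigl(p_1^{1/(d_1+1)},p_2^{1/(d_2+1)},p_3^{1/(d_3+1)},\dots\bigr).$$ Then $L_1$ and $L_2$ both have property $(N)$, but their compositum $L_1L_2$ does not have property $(N)$. -/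

import Mathlib

/-- The field of algebraic numbers: the algebraic closure of `ℚ` in `ℂ`. -/
abbrev QBar : Type := ↥(algebraicClosure ℚ ℂ)

/-- A set `A` of algebraic numbers has property (N) if for each positive real `X` there are only
finitely many `α ∈ A` with `H(α) ≤ X`, where `H` is the absolute (non-logarithmic) Weil height. -/
def HasPropertyN (A : Set QBar) : Prop :=
  ∀ X : ℝ, 0 < X → {α ∈ A | NumberField.absMulHeight₁ α ≤ X}.Finite

theorem isAlgebraic_rpow_one_div (a b : ℕ) :
    IsAlgebraic ℚ (((a : ℝ) ^ (1 / (b : ℝ)) : ℝ) : ℂ) := by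
  rcases Nat.eq_zero_or_pos b with rfl | hb
  · simpa using isAlgebraic_one
  · apply IsAlgebraic.of_pow hb
    have h : ((a : ℝ) ^ (1 / (b : ℝ))) ^ b = (a : ℝ) := by
      rw [one_div]
      exact Real.rpow_inv_natCast_pow (Nat.cast_nonneg a) hb.ne'
    rw [← Complex.ofReal_pow, h, Complex.ofReal_natCast]
    exact isAlgebraic_natCast a

/-- The real positive root `a ^ (1 / b)` of positive integers `a`, `b`, as an algebraic number. -/
noncomputable def posRoot (a b : ℕ) : QBar :=
  ⟨(((a : ℝ) ^ (1 / (b : ℝ)) : ℝ) : ℂ),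
    mem_algebraicClosure_iff.mpr (isAlgebraic_rpow_one_div a b)⟩

/-- The `(i + 1)`-th prime number: `2` for `i = 0`, `3` for `i = 1`, and so on. -/
noncomputable def primeSeq (i : ℕ) : ℕ := Nat.nth Nat.Prime i

/-- The integer part of `√(log p)`, where `p` is the `(i + 1)`-th prime number. -/
noncomputable def degSeq (i : ℕ) : ℕ := ⌊Real.sqrt (Real.log (primeSeq i))⌋₊

/-- The field generated over `ℚ` by the roots `p_i ^ (1 / d_i)`, `i = 1, 2, 3, …`. -/
noncomputable def fieldL₁ : IntermediateField ℚ QBar :=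
  IntermediateField.adjoin ℚ {x | ∃ i : ℕ, 1 ≤ i ∧ x = posRoot (primeSeq i) (degSeq i)}

/-- The field generated over `ℚ` by the roots `p_i ^ (1 / (d_i + 1))`, `i = 1, 2, 3, …`. -/
noncomputable def fieldL₂ : IntermediateField ℚ QBar :=
  IntermediateField.adjoin ℚ {x | ∃ i : ℕ, 1 ≤ i ∧ x = posRoot (primeSeq i) (degSeq i + 1)}

/-! Let `r i` be a root of order `e i` of the prime `p i`, and let `K n` be the field generated by
the `r i` with `i < n`. The positive half rests on a lower bound for heights of elements that are
new in this tower: if `α` lies in `K (n+1)` but not in `K n`, then `p n ≤ (2 * H(α)^2) ^ e n`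
(`le_two_mul_absMulHeight₁_sq_pow`).

To see this, pass to a Galois closure and take `σ` fixing `K n` and moving `α`. The earlier primes
and exponents are coprime to `p n`, so `K n` is unramified above `p n`, and adjoining `r n` is
totally ramified there. Hence `σ` moves `α` only by a multiple of `r n`, up to the denominators of
`α` and `σ α` (`sub_le_of_isUniformizerOn`). The product formula for `α - σ α` turns this local
divisibility into the bound, since conjugates have equal height.

When `e n` is about `√(log p n)`, the quantity `p n ^ (1 / e n)` tends to infinity. Elements of
bounded height therefore all lie in one number field `K N`, where Northcott's theorem applies. This
covers `fieldL₁` and `fieldL₂`.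

The compositum contains `p^(1/d) / p^(1/(d+1)) = p^(1/(d(d+1)))`. Its height is this same number,
which stays bounded because `d(d+1)` has the order of `log p`. Distinct primes give distinct
elements, so property (N) fails. -/

/-! ### Value groups under unramified radical extensions -/

section ValueGroup

open Polynomial

variable {F E : Type*} [Field F] [Field E] [Algebra F E]

/-- The elements of the subfield `K` that are integral for the nonarchimedean absolute value `w`. -/
def AbsoluteValue.integersIn (w : AbsoluteValue E ℝ) (hw : IsNonarchimedean w)
    (K : IntermediateField F E) : Subring E where
  carrier := {x | x ∈ K ∧ w x ≤ 1}
  mul_mem' := fun ⟨ha, ha'⟩ ⟨hb, hb'⟩ ↦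
    ⟨mul_mem ha hb, by rw [map_mul]; exact mul_le_one₀ ha' (w.nonneg _) hb'⟩
  one_mem' := ⟨one_mem K, by simp⟩
  add_mem' := fun ⟨ha, ha'⟩ ⟨hb, hb'⟩ ↦ ⟨add_mem ha hb, (hw _ _).trans (max_le ha' hb')⟩
  zero_mem' := ⟨zero_mem K, by simp⟩
  neg_mem' := fun ⟨ha, ha'⟩ ↦ ⟨neg_mem ha, by simpa using ha'⟩

/-- Every nonzero element of `K` has the absolute value of a power of `ϖ`. -/
def AbsoluteValue.IsUniformizerOn (w : AbsoluteValue E ℝ) (ϖ : E) (K : Set E) : Prop :=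
  ∀ x ∈ K, x ≠ 0 → ∃ k : ℤ, w x = w ϖ ^ k

variable {w : AbsoluteValue E ℝ} (hw : IsNonarchimedean w) {K : IntermediateField F E}

theorem AbsoluteValue.integersIn_le_one (x : w.integersIn hw K) : w (x : E) ≤ 1 := x.2.2

theorem AbsoluteValue.aeval_le_one {θ : E} (hθ : w θ ≤ 1) (G : (w.integersIn hw K)[X]) :
    w (aeval θ G) ≤ 1 := by
  induction G using Polynomial.induction_on' with
  | add p q hp hq => rw [map_add]; exact (hw _ _).trans (max_le hp hq)
  | monomial n a =>
    rw [aeval_monomial, map_mul, map_pow]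
    exact mul_le_one₀ a.2.2 (pow_nonneg (w.nonneg _) _) (pow_le_one₀ (w.nonneg _) hθ)

theorem AbsoluteValue.dvd_of_lt_one {ϖ : w.integersIn hw K} (h0 : w (ϖ : E) ≠ 0)
    (h1 : w (ϖ : E) < 1) (hK : w.IsUniformizerOn ϖ K) {a : w.integersIn hw K}
    (ha : w (a : E) < 1) : ϖ ∣ a := by
  by_cases ha0 : (a : E) = 0
  · exact ⟨0, Subtype.ext (by simp [ha0])⟩
  have hpos : 0 < w (ϖ : E) := lt_of_le_of_ne (w.nonneg _) h0.symm
  have hϖ0 : (ϖ : E) ≠ 0 := fun h ↦ h0 (by simp [h])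
  obtain ⟨k, hk⟩ := hK a a.2.1 ha0
  have hk1 : 1 ≤ k := by
    by_contra! hlt
    have : 1 ≤ w (ϖ : E) ^ k := by
      rw [show k = -((-k).toNat : ℤ) by omega, zpow_neg, zpow_natCast]
      exact (one_le_inv₀ (by positivity)).2 (pow_le_one₀ hpos.le h1.le)
    linarith
  refine ⟨⟨a / ϖ, div_mem a.2.1 ϖ.2.1, ?_⟩, Subtype.ext ?_⟩
  · rw [map_div₀, hk, div_eq_mul_inv, ← zpow_sub_one₀ h0, show k - 1 = ((k - 1).toNat : ℤ) by omega, zpow_natCast]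
    exact pow_le_one₀ hpos.le h1.le
  · simp [mul_div_cancel₀ _ hϖ0]

/-- Coefficients above the highest unit coefficient may be dropped, and the unit made monic. -/
theorem AbsoluteValue.exists_monic_of_coeff_eq_one {θ : E} (hθ : w θ ≤ 1)
    {R : (w.integersIn hw K)[X]} (hR : w (aeval θ R) < 1) (hu : ∃ i, w (R.coeff i : E) = 1) :
    ∃ g : (w.integersIn hw K)[X], g.Monic ∧ g.natDegree ≤ R.natDegree ∧ w (aeval θ g) < 1 := by
  induction hn : R.natDegree using Nat.strong_induction_on generalizing R with
  | _ n ih =>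
  subst hn
  obtain ⟨i, hi⟩ := hu
  have hR0 : R ≠ 0 := by rintro rfl; simp at hi
  by_cases hlead : w (R.leadingCoeff : E) = 1
  · have hne : (R.leadingCoeff : E) ≠ 0 := fun h ↦ by simp [h] at hlead
    let u : w.integersIn hw K :=
      ⟨(R.leadingCoeff : E)⁻¹, inv_mem R.leadingCoeff.2.1, by rw [map_inv₀, hlead, inv_one]⟩
    have hu : u * R.leadingCoeff = 1 := Subtype.ext (inv_mul_cancel₀ hne)
    refine ⟨C u * R, monic_C_mul_of_mul_leadingCoeff_eq_one hu, natDegree_C_mul_le _ _, ?_⟩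
    rw [map_mul, aeval_C, map_mul]
    have : w (algebraMap (w.integersIn hw K) E u) = 1 := by
      change w ((R.leadingCoeff : E)⁻¹) = 1
      rw [map_inv₀, hlead, inv_one]
    rwa [this, one_mul]
  · have hlt : w (R.leadingCoeff : E) < 1 := lt_of_le_of_ne R.leadingCoeff.2.2 hlead
    have hine : i ≠ R.natDegree := by rintro rfl; exact hlead hi
    have hcoef : w (R.eraseLead.coeff i : E) = 1 := by rw [eraseLead_coeff_of_ne _ hine, hi]
    have hile : i ≤ R.natDegree := le_natDegree_of_ne_zero (fun h ↦ by simp [h] at hi)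
    have hev : w (aeval θ R.eraseLead) < 1 := by
      have h1 : aeval θ R.eraseLead
          = aeval θ R - aeval θ (monomial R.natDegree R.leadingCoeff) := by
        rw [← map_sub, self_sub_monomial_natDegree_leadingCoeff]
      rw [h1, sub_eq_add_neg]
      refine (hw _ _).trans_lt (max_lt hR ?_)
      rw [AbsoluteValue.map_neg, aeval_monomial, map_mul, map_pow]
      exact mul_lt_one_of_nonneg_of_lt_one_left (w.nonneg _) hlt (pow_le_one₀ (w.nonneg _) hθ)
    have hdeg : R.eraseLead.natDegree < R.natDegree :=
      (eraseLead_natDegree_lt_or_eraseLead_eq_zero R).resolve_right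
        (fun h ↦ by simp [h] at hcoef)
    obtain ⟨g, h1, h2, h3⟩ := ih _ hdeg hev ⟨i, hcoef⟩ rfl
    exact ⟨g, h1, h2.trans hdeg.le, h3⟩

/-- If `θ` is a `d`-th root of a unit of `K`, and `d` is a unit, then modulo units the maximal ideal
of the integers of `K[θ]` is still generated by a uniformizer of `K`. -/
theorem AbsoluteValue.exists_mul_eq_mul_of_lt_one {ϖ : w.integersIn hw K} (h0 : w (ϖ : E) ≠ 0)
    (h1 : w (ϖ : E) < 1) (hK : w.IsUniformizerOn ϖ K) {θ : E} (hθ : w θ = 1) {d : ℕ}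
    (hd : d ≠ 0) (hdw : w (d : E) = 1) {q : w.integersIn hw K} (hq : θ ^ d = q)
    (G : (w.integersIn hw K)[X]) (hG : w (aeval θ G) < 1) :
    ∃ h G' : (w.integersIn hw K)[X], w (aeval θ h) = 1 ∧
      aeval θ G * aeval θ h = ϖ * aeval θ G' := by
  classical
  -- A `g` of least degree lifts the minimal polynomial of the residue of `θ` over the residue field
  -- of `K`.
  let S : Set ℕ := {n | ∃ g : (w.integersIn hw K)[X],
    g.Monic ∧ g.natDegree = n ∧ w (aeval θ g) < 1}
  have hroot : aeval θ (X ^ d - C q) = 0 := by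
    rw [map_sub, map_pow, aeval_X, aeval_C, hq]; exact sub_self _
  have hS : S.Nonempty := ⟨_, X ^ d - C q, monic_X_pow_sub_C _ hd, rfl, by simp [hroot]⟩
  obtain ⟨g, hgm, hgd, hgw⟩ := Nat.sInf_mem hS
  have hevC (a : w.integersIn hw K) : algebraMap (w.integersIn hw K) E a = a := rfl
  -- Modulo `ϖ`, `g` divides every polynomial that is small at `θ`: a unit coefficient in the
  -- remainder would yield a monic competitor of smaller degree.
  have key (P : (w.integersIn hw K)[X]) (hP : w (aeval θ P) < 1) :
      ∃ t, P = g * (P /ₘ g) + C ϖ * t := by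
    have hmod : w (aeval θ (P %ₘ g)) < 1 := by
      have h2 : aeval θ (P %ₘ g) = aeval θ P + -(aeval θ g * aeval θ (P /ₘ g)) := by
        rw [← map_mul, ← sub_eq_add_neg, ← map_sub]
        congr 1
        rw [eq_sub_iff_add_eq, modByMonic_add_div P g]
      rw [h2]
      refine (hw _ _).trans_lt (max_lt hP ?_)
      rw [AbsoluteValue.map_neg, map_mul]
      exact mul_lt_one_of_nonneg_of_lt_one_left (w.nonneg _) hgw (w.aeval_le_one hw hθ.le _)
    have hdvd : C ϖ ∣ P %ₘ g := by
      rw [C_dvd_iff_dvd_coeff]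
      by_contra! hex
      obtain ⟨i, hi⟩ := hex
      have hi1 : w ((P %ₘ g).coeff i : E) = 1 := by
        refine le_antisymm (w.integersIn_le_one hw _) ?_
        by_contra! hlt
        exact hi (w.dvd_of_lt_one hw h0 h1 hK hlt)
      obtain ⟨g', hg'm, hg'd, hg'w⟩ := w.exists_monic_of_coeff_eq_one hw hθ.le hmod ⟨i, hi1⟩
      have hg1 : g ≠ 1 := by rintro rfl; simp at hgw
      have hlt := natDegree_modByMonic_lt P hgm hg1
      have hle : sInf S ≤ g'.natDegree := Nat.sInf_le ⟨g', hg'm, rfl, hg'w⟩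
      omega
    obtain ⟨t, ht⟩ := hdvd
    exact ⟨t, by rw [← ht, add_comm, modByMonic_add_div P g]⟩
  obtain ⟨t₀, ht₀⟩ := key (X ^ d - C q) (by simp [hroot])
  obtain ⟨t₁, ht₁⟩ := key G hG
  set h := (X ^ d - C q) /ₘ g with hh
  have hhw : w (aeval θ h) = 1 := by
    refine le_antisymm (w.aeval_le_one hw hθ.le _) ?_
    by_contra! hlt
    -- Separability of `X ^ d - q` modulo `ϖ`: its derivative at `θ` is a unit, whereas `g(θ)` and
    -- `h(θ)` both small would make it small.
    have hder := congrArg (fun P ↦ w (aeval θ (derivative P))) ht₀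
    simp only [derivative_sub, derivative_X_pow, derivative_C, sub_zero,
      derivative_mul, zero_mul, zero_add, map_add, map_mul, aeval_C, map_pow, aeval_X, hθ,
      one_pow, mul_one, map_natCast, hdw, hevC] at hder
    refine absurd hder (ne_of_gt ?_)
    refine (hw _ _).trans_lt (max_lt ((hw _ _).trans_lt (max_lt ?_ ?_)) ?_)
    · rw [map_mul]
      exact mul_lt_one_of_nonneg_of_lt_one_right (w.aeval_le_one hw hθ.le _) (w.nonneg _) hlt
    · rw [map_mul]
      exact mul_lt_one_of_nonneg_of_lt_one_left (w.nonneg _) hgw (w.aeval_le_one hw hθ.le _)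
    · rw [map_mul]
      exact mul_lt_one_of_nonneg_of_lt_one_left (w.nonneg _) h1 (w.aeval_le_one hw hθ.le _)
  refine ⟨h, t₁ * h - t₀ * (G /ₘ g), hhw, ?_⟩
  have e0 : 0 = aeval θ g * aeval θ h + ϖ * aeval θ t₀ := by
    rw [← hroot]
    conv_lhs => rw [ht₀]
    simp [hevC]
  have e1 : aeval θ G = aeval θ g * aeval θ (G /ₘ g) + ϖ * aeval θ t₁ := by
    conv_lhs => rw [ht₁]
    simp [hevC]
  rw [e1]
  simp only [map_sub, map_mul]
  linear_combination -(aeval θ (G /ₘ g)) * e0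

/-- As long as the value is below 1, a factor `ϖ` splits off up to a unit. This stops after finitely
many rounds, because some power of `w ϖ` is already smaller than the nonzero value at the start. -/
theorem AbsoluteValue.exists_aeval_eq_pow {ϖ : w.integersIn hw K} (h0 : w (ϖ : E) ≠ 0)
    (h1 : w (ϖ : E) < 1) (hK : w.IsUniformizerOn ϖ K) {θ : E} (hθ : w θ = 1) {d : ℕ}
    (hd : d ≠ 0) (hdw : w (d : E) = 1) {q : w.integersIn hw K} (hq : θ ^ d = q)
    (G : (w.integersIn hw K)[X]) (hG : aeval θ G ≠ 0) :
    ∃ k : ℕ, w (aeval θ G) = w ϖ ^ k := by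
  obtain ⟨N, hN⟩ := exists_pow_lt_of_lt_one (w.pos hG) h1
  induction N generalizing G with
  | zero => exact absurd (w.aeval_le_one hw hθ.le G) (by simpa using hN)
  | succ N ih =>
    rcases (w.aeval_le_one hw hθ.le G).eq_or_lt with h | h
    · exact ⟨0, by simpa using h⟩
    obtain ⟨r, G', hr, hG'⟩ := w.exists_mul_eq_mul_of_lt_one hw h0 h1 hK hθ hd hdw hq G h
    have hval : w (aeval θ G) = w ϖ * w (aeval θ G') := by
      have := congrArg w hG'
      rwa [map_mul, map_mul, hr, mul_one] at this
    have hne : aeval θ G' ≠ 0 := by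
      intro hz
      rw [hz, map_zero, mul_zero] at hval
      exact hG (by simpa using hval)
    have hpos : 0 < w (ϖ : E) := lt_of_le_of_ne (w.nonneg _) h0.symm
    obtain ⟨k, hk⟩ := ih G' hne (by
      rw [hval, pow_succ'] at hN
      exact lt_of_mul_lt_mul_left hN hpos.le)
    exact ⟨k + 1, by rw [hval, hk, pow_succ']⟩

/-- Clears denominators, reducing polynomials over `K` to polynomials with integral coefficients. -/
theorem AbsoluteValue.exists_pow_mul_aeval_eq {ϖ : w.integersIn hw K} (h1 : w (ϖ : E) < 1)
    (θ : E) (P : K[X]) :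
    ∃ (N : ℕ) (G : (w.integersIn hw K)[X]), (ϖ : E) ^ N * aeval θ P = aeval θ G := by
  induction P using Polynomial.induction_on' with
  | add p q hp hq =>
    obtain ⟨M, G, hG⟩ := hp
    obtain ⟨N, H, hH⟩ := hq
    refine ⟨M + N, C ϖ ^ N * G + C ϖ ^ M * H, ?_⟩
    simp only [map_add, map_mul, map_pow, aeval_C, ← hG, ← hH]
    change _ = (ϖ : E) ^ N * _ + (ϖ : E) ^ M * _
    ring
  | monomial n a =>
    obtain ⟨N, hN⟩ : ∃ N : ℕ, w ((ϖ : E) ^ N * a) ≤ 1 := by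
      by_cases ha : (a : E) = 0
      · exact ⟨0, by simp [ha]⟩
      obtain ⟨N, hN⟩ := exists_pow_lt_of_lt_one (inv_pos.2 (w.pos ha)) h1
      refine ⟨N, ?_⟩
      rw [map_mul, map_pow]
      calc w (ϖ : E) ^ N * w a ≤ (w a)⁻¹ * w a := by gcongr
        _ = 1 := inv_mul_cancel₀ (w.pos ha).ne'
    refine ⟨N, monomial n ⟨_, mul_mem (pow_mem ϖ.2.1 N) a.2, hN⟩, ?_⟩
    rw [aeval_monomial, aeval_monomial]
    exact (mul_assoc _ _ _).symm

/-- Adjoining a `d`-th root of a unit, where `d` is a unit, does not change the value group. -/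
theorem AbsoluteValue.IsUniformizerOn.adjoin_root {ϖ : E} (hϖ : ϖ ∈ K) (h0 : w ϖ ≠ 0)
    (h1 : w ϖ < 1) (hK : w.IsUniformizerOn ϖ K) {θ : E} (hθ : w θ = 1) {d : ℕ}
    (hd : d ≠ 0) (hdw : w (d : E) = 1) (hq : θ ^ d ∈ K) (hw : IsNonarchimedean w) :
    w.IsUniformizerOn ϖ (IntermediateField.adjoin K {θ}) := by
  let ϖ' : w.integersIn hw K := ⟨ϖ, hϖ, h1.le⟩
  let q : w.integersIn hw K := ⟨θ ^ d, hq, by simp [hθ]⟩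
  have hpoly (P : K[X]) (hP : aeval θ P ≠ 0) : ∃ k : ℤ, w (aeval θ P) = w ϖ ^ k := by
    obtain ⟨N, G, hG⟩ := w.exists_pow_mul_aeval_eq hw (ϖ := ϖ') h1 θ P
    have hϖ0 : ϖ ≠ 0 := fun h ↦ h0 (by simp [h])
    obtain ⟨k, hk⟩ := w.exists_aeval_eq_pow hw (ϖ := ϖ') h0 h1 hK hθ hd hdw (q := q) rfl G
      (by rw [← hG]; exact mul_ne_zero (pow_ne_zero _ hϖ0) hP)
    refine ⟨k - N, ?_⟩
    rw [← hG, map_mul, map_pow] at hk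
    rw [zpow_sub₀ h0, zpow_natCast, zpow_natCast, eq_div_iff (pow_ne_zero _ h0), mul_comm]
    exact hk
  intro x hx hx0
  obtain ⟨r, s, rfl⟩ := (IntermediateField.mem_adjoin_simple_iff K x).1 hx
  obtain ⟨hr, hs⟩ := div_ne_zero_iff.1 hx0
  obtain ⟨a, ha⟩ := hpoly r hr
  obtain ⟨b, hb⟩ := hpoly s hs
  exact ⟨a - b, by rw [map_div₀, ha, hb, zpow_sub₀ h0]⟩

end ValueGroup

/-! ### Conjugates in a totally ramified radical extension -/

section LocalInequality

open Polynomial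

variable {F E : Type*} [Field F] [Field E] [Algebra F E]
  {w : AbsoluteValue E ℝ} {K : IntermediateField F E}

/-- The terms of an expansion in a root `π` of the uniformizer have distinct absolute values. -/
theorem AbsoluteValue.term_le_sum {ϖ π : E} {d : ℕ} (hw : IsNonarchimedean w)
    (hK : w.IsUniformizerOn ϖ K) (h0 : 0 < w ϖ) (h1 : w ϖ < 1) (hπ : π ^ d = ϖ) {a : ℕ → E}
    (ha : ∀ j < d, a j ∈ K) {j : ℕ} (hj : j < d) :
    w (a j * π ^ j) ≤ w (∑ i ∈ Finset.range d, a i * π ^ i) := by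
  have hd : d ≠ 0 := by omega
  have ht : w π ^ d = w ϖ := by rw [← map_pow, hπ]
  have ht0 : 0 < w π := w.pos (by rintro rfl; simp [← hπ, hd] at h0)
  have ht1 : w π < 1 := by
    by_contra! h
    exact absurd (one_le_pow₀ h (n := d)) (by rw [ht]; exact not_le.2 h1)
  by_cases hz : a j * π ^ j = 0
  · simp [hz]
  obtain ⟨i, hi, hmax⟩ := Finset.exists_max_image (Finset.range d) (fun i ↦ w (a i * π ^ i))
    ⟨j, Finset.mem_range.2 hj⟩
  have hipos : 0 < w (a i * π ^ i) := (w.pos hz).trans_le (hmax j (Finset.mem_range.2 hj))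
  -- The exponent of `w π` in the `l`-th term is `l` modulo `d`, so nonzero terms never tie and the
  -- ultrametric sum has the size of its largest term.
  have hval (l : ℕ) (hl : l < d) (hl0 : a l * π ^ l ≠ 0) :
      ∃ k : ℤ, w (a l * π ^ l) = w π ^ (d * k + l) := by
    obtain ⟨k, hk⟩ := hK _ (ha l hl) (left_ne_zero_of_mul hl0)
    refine ⟨k, ?_⟩
    rw [map_mul, map_pow, hk, ← ht, zpow_add₀ ht0.ne', zpow_mul, zpow_natCast, zpow_natCast]
  rw [hw.apply_sum_eq_of_lt (fun x ↦ (AbsoluteValue.map_neg w x).symm) hi]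
  · exact hmax j (Finset.mem_range.2 hj)
  intro l hl hli
  refine lt_of_le_of_ne (hmax l hl) fun heq ↦ hli ?_
  rw [Finset.mem_range] at hl hi
  obtain ⟨k, hk⟩ := hval l hl (by rw [← w.pos_iff, heq]; exact hipos)
  obtain ⟨m, hm⟩ := hval i hi (w.pos_iff.1 hipos)
  rw [hk, hm] at heq
  have := zpow_right_injective₀ ht0 ht1.ne heq
  have h2 : ((l : ℤ) : ℤ) % d = (i : ℤ) % d := by
    have h3 : (l : ℤ) = i + d * (m - k) := by linear_combination this
    rw [h3, Int.add_mul_emod_self_left]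
  rw [Int.emod_eq_of_lt (by omega) (by omega), Int.emod_eq_of_lt (by omega) (by omega)] at h2
  exact_mod_cast h2

/-- Two conjugates over `K` in a totally ramified extension of degree `d` are close. -/
theorem AbsoluteValue.sub_le_of_isUniformizerOn {ϖ π π' : E} {d : ℕ} (hw : IsNonarchimedean w)
    (hK : w.IsUniformizerOn ϖ K) (h0 : 0 < w ϖ) (h1 : w ϖ < 1) (hd : d ≠ 0) (hπ : π ^ d = ϖ)
    (hπ' : π' ^ d = ϖ) {a : ℕ → E} (ha : ∀ j < d, a j ∈ K) :
    w (∑ i ∈ Finset.range d, a i * π ^ i - ∑ i ∈ Finset.range d, a i * π' ^ i) ≤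
      w π * (max (w (∑ i ∈ Finset.range d, a i * π ^ i)) 1 *
        max (w (∑ i ∈ Finset.range d, a i * π' ^ i)) 1) := by
  have ht : w π ^ d = w ϖ := by rw [← map_pow, hπ]
  have ht' : w π' = w π := by
    refine (pow_left_inj₀ (w.nonneg _) (w.nonneg _) hd).1 ?_
    rw [ht, ← map_pow, hπ']
  have ht0 : 0 < w π := w.pos (by rintro rfl; simp [← hπ, hd] at h0)
  have ht1 : w π < 1 := by
    by_contra! h
    exact absurd (one_le_pow₀ h (n := d)) (by rw [ht]; exact not_le.2 h1)
  set M := w (∑ i ∈ Finset.range d, a i * π ^ i)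
  set M' := w (∑ i ∈ Finset.range d, a i * π' ^ i)
  have hB : 0 ≤ w π * (max M 1 * max M' 1) := by positivity
  rw [← Finset.sum_sub_distrib]
  refine Finset.sum_induction _ (fun x ↦ w x ≤ w π * (max M 1 * max M' 1))
    (fun x y hx hy ↦ (hw x y).trans (max_le hx hy)) (by simp [hB]) fun j hj ↦ ?_
  rw [Finset.mem_range] at hj
  rcases Nat.eq_zero_or_pos j with rfl | hj0
  · simp [hB]
  by_cases haj : a j = 0
  · simp [haj, hB]
  obtain ⟨k, hk⟩ := hK _ (ha j hj) haj
  have hT : w (a j * π ^ j) = w π ^ (d * k + j) := by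
    rw [map_mul, map_pow, hk, ← ht, zpow_add₀ ht0.ne', zpow_mul, zpow_natCast, zpow_natCast]
  have hT' : w (a j * π' ^ j) = w (a j * π ^ j) := by simp [ht']
  have hTM : w (a j * π ^ j) ≤ max M 1 :=
    le_max_of_le_left (w.term_le_sum hw hK h0 h1 hπ ha hj)
  have hTM' : w (a j * π ^ j) ≤ max M' 1 := by
    rw [← hT']
    exact le_max_of_le_left (w.term_le_sum hw hK h0 h1 hπ' ha hj)
  have hle : w (a j * π ^ j - a j * π' ^ j) ≤ w (a j * π ^ j) := by
    rw [sub_eq_add_neg]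
    refine (hw _ _).trans (max_le le_rfl ?_)
    rw [AbsoluteValue.map_neg, hT']
  refine hle.trans ?_
  -- As `0 < j < d`, the term `T` is not a unit. So either `w T ≤ w π`, or `w T ≥ 1 / w π` and then
  -- `w T ≤ w π * w T ^ 2`; this is why both maxima appear in the bound.
  have hm : (d : ℤ) * k + j ≠ 0 := by
    intro h
    have : (d : ℤ) ∣ j := ⟨-k, by linarith⟩
    have := Nat.le_of_dvd hj0 (by exact_mod_cast this)
    omega
  rcases lt_or_gt_of_ne hm with hneg | hpos
  · have h2 : 1 ≤ w π * w (a j * π ^ j) := by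
      rw [hT, ← zpow_one_add₀ ht0.ne']
      exact one_le_zpow_of_nonpos₀ ht0 ht1.le (by omega)
    calc w (a j * π ^ j) ≤ (w π * w (a j * π ^ j)) * w (a j * π ^ j) :=
          le_mul_of_one_le_left (w.nonneg _) h2
      _ = w π * (w (a j * π ^ j) * w (a j * π ^ j)) := mul_assoc _ _ _
      _ ≤ _ := by gcongr
  · calc w (a j * π ^ j) = w π ^ ((d : ℤ) * k + j - 1) * w π := by
          rw [hT, zpow_sub_one₀ ht0.ne', inv_mul_cancel_right₀ ht0.ne']
      _ ≤ 1 * w π := by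
          gcongr
          rw [show (d : ℤ) * k + j - 1 = (((d : ℤ) * k + j - 1).toNat : ℤ) by omega, zpow_natCast]
          exact pow_le_one₀ ht0.le ht1.le
      _ ≤ w π * (max M 1 * max M' 1) := by
          rw [one_mul]
          exact le_mul_of_one_le_right ht0.le
            (one_le_mul_of_one_le_of_one_le (le_max_right _ _) (le_max_right _ _))

end LocalInequality

/-! ### The prime `p` as a uniformizer -/

section Rational

open Polynomial

variable {E : Type*} [Field E] [CharZero E] {w : AbsoluteValue E ℝ}

theorem AbsoluteValue.natCast_eq_one_of_coprime (hw : IsNonarchimedean w) {p n : ℕ}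
    (hp : w (p : E) < 1) (hn : Nat.Coprime n p) : w (n : E) = 1 := by
  have hint (m : ℤ) : w (m : E) ≤ 1 := hw.apply_intCast_le_one
  refine le_antisymm (by exact_mod_cast hint n) ?_
  by_contra! hlt
  have hb : (n : ℤ) * n.gcdA p + p * n.gcdB p = 1 := by
    rw [← Nat.gcd_eq_gcd_ab, hn.gcd_eq_one, Nat.cast_one]
  have hE : (n : E) * (n.gcdA p : ℤ) + p * (n.gcdB p : ℤ) = 1 := by exact_mod_cast hb
  have : w (1 : E) < 1 := by
    rw [← hE]
    refine (hw _ _).trans_lt (max_lt ?_ ?_)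
    · rw [map_mul]; exact mul_lt_one_of_nonneg_of_lt_one_left (w.nonneg _) hlt (hint _)
    · rw [map_mul]; exact mul_lt_one_of_nonneg_of_lt_one_left (w.nonneg _) hp (hint _)
  simp at this

theorem AbsoluteValue.isUniformizerOn_bot (hw : IsNonarchimedean w) {p : ℕ} (hp : p.Prime)
    (hpw : w (p : E) < 1) : w.IsUniformizerOn p (⊥ : IntermediateField ℚ E) := by
  have hp0 : w (p : E) ≠ 0 := by simpa using hp.ne_zero
  have hnat (n : ℕ) (hn : n ≠ 0) : ∃ k : ℕ, w (n : E) = w (p : E) ^ k := by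
    obtain ⟨k, m, hm, rfl⟩ := Nat.exists_eq_pow_mul_and_not_dvd hn p hp.ne_one
    refine ⟨k, ?_⟩
    rw [Nat.cast_mul, Nat.cast_pow, map_mul, map_pow,
      w.natCast_eq_one_of_coprime hw hpw ((hp.coprime_iff_not_dvd.2 hm).symm), mul_one]
  intro x hx hx0
  obtain ⟨q, rfl⟩ := IntermediateField.mem_bot.1 hx
  have hq : q ≠ 0 := by rintro rfl; simp at hx0
  obtain ⟨a, ha⟩ := hnat q.num.natAbs (by simpa using hq)
  obtain ⟨b, hb⟩ := hnat q.den q.den_nz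
  have hna : w ((q.num : ℤ) : E) = w (q.num.natAbs : E) := by
    rcases Int.natAbs_eq q.num with h | h
    · conv_lhs => rw [h]
      simp
    · conv_lhs => rw [h]
      rw [Int.cast_neg, AbsoluteValue.map_neg, Int.cast_natCast]
  refine ⟨a - b, ?_⟩
  rw [eq_ratCast, Rat.cast_def, map_div₀, hna, ha, hb, zpow_sub₀ hp0, zpow_natCast, zpow_natCast]

/-- A prime `p` stays a uniformizer after adjoining roots that are prime to `p`. -/
theorem AbsoluteValue.isUniformizerOn_adjoin_roots (hw : IsNonarchimedean w) {p : ℕ}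
    (hp : p.Prime) (hpw : w (p : E) < 1) {r : ℕ → E} {q e : ℕ → ℕ} {n : ℕ}
    (he : ∀ i < n, e i ≠ 0) (hr : ∀ i < n, r i ^ e i = q i)
    (hq : ∀ i < n, Nat.Coprime (q i) p) (hep : ∀ i < n, Nat.Coprime (e i) p) :
    w.IsUniformizerOn p (IntermediateField.adjoin ℚ (r '' Set.Iio n)) := by
  induction n with
  | zero => simpa using w.isUniformizerOn_bot hw hp hpw
  | succ n ih =>
    have ih' := ih (fun i hi ↦ he i (by omega)) (fun i hi ↦ hr i (by omega))
      (fun i hi ↦ hq i (by omega)) (fun i hi ↦ hep i (by omega))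
    have hp0 : w (p : E) ≠ 0 := by simpa using hp.ne_zero
    have hqn := w.natCast_eq_one_of_coprime hw hpw (hq n n.lt_succ_self)
    have hθ : w (r n) = 1 := by
      rw [← hr n n.lt_succ_self, map_pow] at hqn
      exact (pow_eq_one_iff_of_nonneg (w.nonneg _) (he n n.lt_succ_self)).1 hqn
    have := AbsoluteValue.IsUniformizerOn.adjoin_root
      (K := IntermediateField.adjoin ℚ (r '' Set.Iio n)) (natCast_mem _ p) hp0 hpw ih' hθ
      (he n n.lt_succ_self) (w.natCast_eq_one_of_coprime hw hpw (hep n n.lt_succ_self))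
      (by rw [hr n n.lt_succ_self]; exact natCast_mem _ _) hw
    rw [show Set.Iio (n + 1) = insert n (Set.Iio n) from Order.Iio_succ_eq_insert n,
      Set.image_insert_eq, Set.insert_eq, Set.union_comm,
      ← IntermediateField.adjoin_adjoin_left]
    exact this

end Rational

/-! ### Power expansions in a radical extension -/

section Expansion

open Polynomial

variable {F E : Type*} [Field F] [Field E] [Algebra F E]

/-- Elements of `K(π)` with `π ^ d ∈ K` are combinations of `1, π, …, π ^ (d - 1)`. -/
theorem IntermediateField.exists_eq_sum_range_of_mem_adjoin (K : IntermediateField F E) {π : E}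
    {d : ℕ} (hd : d ≠ 0) (hπ : π ^ d ∈ K) {x : E} (hx : x ∈ IntermediateField.adjoin K {π}) :
    ∃ a : ℕ → E, (∀ i, a i ∈ K) ∧ x = ∑ i ∈ Finset.range d, a i * π ^ i := by
  let f : K[X] := X ^ d - C ⟨π ^ d, hπ⟩
  have hf : f.Monic := monic_X_pow_sub_C _ hd
  have hfd : f.natDegree = d := natDegree_X_pow_sub_C
  have hroot : aeval π f = 0 := by
    rw [map_sub, map_pow, aeval_X, aeval_C]; exact sub_self _
  have halg : IsAlgebraic K π := ⟨f, hf.ne_zero, hroot⟩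
  rw [← IntermediateField.mem_toSubalgebra,
    IntermediateField.adjoin_simple_toSubalgebra_of_isAlgebraic halg,
    Algebra.adjoin_singleton_eq_range_aeval] at hx
  obtain ⟨P, rfl⟩ := hx
  refine ⟨fun i ↦ (P %ₘ f).coeff i, fun i ↦ ((P %ₘ f).coeff i).2, ?_⟩
  have h1 : aeval π P = aeval π (P %ₘ f) := by
    conv_lhs => rw [← modByMonic_add_div P f]
    simp [hroot]
  have hf1 : f ≠ 1 := by
    intro h
    rw [h, natDegree_one] at hfd
    exact hd hfd.symm
  change aeval π P = _
  rw [h1, aeval_eq_sum_range' (hfd ▸ natDegree_modByMonic_lt P hf hf1)]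
  rfl

end Expansion

/-! ### Heights under field extension and conjugation -/

section HeightExtension

open NumberField Height Module

variable {K E : Type*} [Field K] [NumberField K] [Field E] [NumberField E]

theorem NumberField.InfinitePlace.prod_pow_mult_eq_prod_embeddings {M : Type*} [CommMonoid M]
    (f : InfinitePlace K → M) :
    ∏ v : InfinitePlace K, f v ^ v.mult = ∏ φ : K →+* ℂ, f (.mk φ) := by
  classical
  rw [← Finset.univ.prod_fiberwise (fun φ : K →+* ℂ ↦ InfinitePlace.mk φ)]
  refine Finset.prod_congr rfl fun v _ ↦ ?_
  rw [Finset.prod_congr rfl (g := fun _ ↦ f v) (fun φ hφ ↦ by rw [(Finset.mem_filter.1 hφ).2]),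
    Finset.prod_const, InfinitePlace.card_filter_mk_eq]

theorem NumberField.prod_embeddings_comp {M : Type*} [CommMonoid M] [Algebra K E]
    (g : (K →+* ℂ) → M) :
    ∏ ψ : E →+* ℂ, g (ψ.comp (algebraMap K E)) = (∏ φ : K →+* ℂ, g φ) ^ finrank K E := by
  classical
  rw [← Finset.univ.prod_fiberwise (fun ψ : E →+* ℂ ↦ ψ.comp (algebraMap K E)),
    ← Finset.prod_pow]
  refine Finset.prod_congr rfl fun φ _ ↦ ?_
  rw [Finset.prod_congr rfl (g := fun _ ↦ g φ) (fun ψ hψ ↦ by rw [(Finset.mem_filter.1 hψ).2]),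
    Finset.prod_const]
  congr 1
  let := φ.toAlgebra
  rw [← AlgHom.card K E ℂ, ← Fintype.card_subtype]
  refine Fintype.card_congr ⟨fun ψ ↦ { ψ.1 with commutes' := fun x ↦ RingHom.congr_fun ψ.2 x },
    fun ψ ↦ ⟨ψ, RingHom.ext ψ.commutes⟩, fun _ ↦ rfl, fun _ ↦ rfl⟩

/-- The finite places contribute the inverse norm of the ideal `(a, n)` to the height of `x = a /
n`. This leaves an ideal norm and a product over embeddings, both easy to follow in an extension. -/
theorem NumberField.mulHeight₁_mul_absNorm_span {x : K} {n : ℕ} (hn : n ≠ 0) {a : 𝓞 K}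
    (ha : n * x = a) :
    mulHeight₁ x * (Ideal.span {a, (n : 𝓞 K)}).absNorm =
      ∏ φ : K →+* ℂ, max ‖φ a‖ n := by
  have hn' : (n : K) ≠ 0 := mod_cast hn
  have hv (i : Fin 2) : ((![a, (n : 𝓞 K)] i : 𝓞 K) : K) = ![(a : K), n] i := by
    fin_cases i <;> rfl
  have h1 := absNorm_mul_finprod_finitePlace_eq_one (x := ![a, (n : 𝓞 K)]) (by simp [hn])
  simp only [hv] at h1
  have hspan : Set.range ![a, (n : 𝓞 K)] = {a, (n : 𝓞 K)} := by
    simp [Matrix.range_cons, Set.pair_comm]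
  rw [hspan] at h1
  rw [← mul_div_cancel_left₀ x hn', ha, mulHeight₁_div_eq_mulHeight, mulHeight_eq (by simp [hn]),
    mul_assoc, mul_comm (finprod _), h1, mul_one,
    InfinitePlace.prod_pow_mult_eq_prod_embeddings fun v ↦ ⨆ i, v (![(a : K), n] i)]
  refine Finset.prod_congr rfl fun φ _ ↦ ?_
  apply le_antisymm
  · refine ciSup_le fun i ↦ ?_
    fin_cases i <;> simp
  · refine max_le (Finite.le_ciSup_of_le 0 ?_) (Finite.le_ciSup_of_le 1 ?_) <;> simp

/-- Both the norm of the extended ideal and the product over embeddings get raised to the power `[E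
: K]`, each embedding of `K` having that many extensions. -/
theorem NumberField.mulHeight₁_algebraMap [Algebra K E] (x : K) :
    mulHeight₁ (algebraMap K E x) = mulHeight₁ x ^ finrank K E := by
  obtain ⟨n, hn, a, ha, -⟩ := exists_nat_ne_zero_exists_integer_mul_eq_and_absNorm_span_eq_pow x
  have h1 := mulHeight₁_mul_absNorm_span hn ha
  let b : 𝓞 E := algebraMap (𝓞 K) (𝓞 E) a
  have hb : n * algebraMap K E x = b := by
    rw [← map_natCast (algebraMap K E), ← map_mul, ha]
    rfl
  have h2 := mulHeight₁_mul_absNorm_span hn hb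
  have hspan : Ideal.span {b, (n : 𝓞 E)}
      = (Ideal.span {a, (n : 𝓞 K)}).map (algebraMap (𝓞 K) (𝓞 E)) := by
    rw [Ideal.map_span, Set.image_pair, map_natCast]
  have hfin : finrank (𝓞 K) (𝓞 E) = finrank K E :=
    (IsFractionRing.finrank_eq (𝓞 K) K (𝓞 E) E).symm
  rw [hspan, Ideal.absNorm_algebraMap, hfin, Nat.cast_pow] at h2
  have h3 : ∏ ψ : E →+* ℂ, max ‖ψ b‖ n = (∏ φ : K →+* ℂ, max ‖φ a‖ (n : ℝ)) ^ finrank K E :=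
    prod_embeddings_comp (K := K) (E := E) fun φ ↦ max ‖φ a‖ (n : ℝ)
  rw [h3, ← h1, mul_pow] at h2
  refine mul_right_cancel₀ (pow_ne_zero _ ?_) h2
  rw [Nat.cast_ne_zero, Ne, Ideal.absNorm_eq_zero_iff, Ideal.span_eq_bot]
  intro h
  exact hn (by simpa using h n (by simp))

theorem NumberField.mulHeight₁_ringHom_pow_finrank (f : K →+* E) (x : K) :
    mulHeight₁ (f x) ^ finrank ℚ K = mulHeight₁ x ^ finrank ℚ E := by
  let := f.toAlgebra
  rw [← finrank_mul_finrank ℚ K E, mul_comm, pow_mul]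
  exact congrArg (· ^ finrank ℚ K) (mulHeight₁_algebraMap x)

theorem NumberField.mulHeight₁_ringEquiv (σ : K ≃+* E) (x : K) :
    mulHeight₁ (σ x) = mulHeight₁ x := by
  have h := mulHeight₁_ringHom_pow_finrank σ.toRingHom x
  rw [← (σ.toRatAlgEquiv).toLinearEquiv.finrank_eq] at h
  exact (pow_left_inj₀ (mulHeight₁_nonneg _) (mulHeight₁_nonneg _) finrank_pos.ne').1 h

end HeightExtension

/-! ### Height bound from the product formula -/

section GaloisBound

open NumberField Height Module

variable {E : Type*} [Field E] [NumberField E]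

theorem NumberField.hasFiniteMulSupport_max_one (x : E) :
    (fun v : FinitePlace E ↦ max (v x) 1).HasFiniteMulSupport := by
  rcases eq_or_ne x 0 with rfl | hx
  · simp [Function.HasFiniteMulSupport]
  · have := FinitePlace.hasFiniteMulSupport hx
    fun_prop

/-- If `α` and `β` are `π`-close at every finite place, the product formula bounds their heights
from below in terms of `π`. -/
theorem NumberField.pow_finrank_le_of_forall_sub_le {α β π : E} (hne : α ≠ β) {p d : ℕ}
    (hp : p ≠ 0) (hd : d ≠ 0) (hπ : π ^ d = p)
    (h : ∀ v : FinitePlace E, v (α - β) ≤ v π * (max (v α) 1 * max (v β) 1)) :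
    (p : ℝ) ^ finrank ℚ E ≤ (2 ^ finrank ℚ E * (mulHeight₁ α * mulHeight₁ β)) ^ d := by
  have hπ0 : π ≠ 0 := by
    rintro rfl
    rw [zero_pow hd] at hπ
    exact hp (by exact_mod_cast hπ.symm)
  have hsub : α - β ≠ 0 := sub_ne_zero.2 hne
  have hfin : ∏ᶠ v : FinitePlace E, v (α - β) ≤ (∏ᶠ v : FinitePlace E, v π) *
      ((∏ᶠ v : FinitePlace E, max (v α) 1) * ∏ᶠ v : FinitePlace E, max (v β) 1) := by
    have hα := hasFiniteMulSupport_max_one α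
    have hβ := hasFiniteMulSupport_max_one β
    have hπs := FinitePlace.hasFiniteMulSupport hπ0
    have hαβ : (fun v : FinitePlace E ↦ max (v α) 1 * max (v β) 1).HasFiniteMulSupport :=
      hα.mul hβ
    rw [← finprod_mul_distrib hα hβ, ← finprod_mul_distrib hπs hαβ]
    exact finprod_le_finprod (FinitePlace.hasFiniteMulSupport hsub) (fun v ↦ v.1.nonneg _)
      (hπs.mul hαβ) h
  have hinf : ∏ v : InfinitePlace E, v (α - β) ^ v.mult ≤ 2 ^ finrank ℚ E *
      ((∏ v : InfinitePlace E, max (v α) 1 ^ v.mult) *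
        ∏ v : InfinitePlace E, max (v β) 1 ^ v.mult) := by
    rw [← InfinitePlace.sum_mult_eq, ← Finset.prod_pow_eq_pow_sum, ← Finset.prod_mul_distrib,
      ← Finset.prod_mul_distrib]
    refine Finset.prod_le_prod (fun v _ ↦ pow_nonneg (v.1.nonneg _) _) fun v _ ↦ ?_
    rw [← mul_pow, ← mul_pow]
    refine pow_le_pow_left₀ (v.1.nonneg _) ?_ _
    have h1 : v (α - β) ≤ v α + v β := by
      rw [sub_eq_add_neg]
      refine (v.1.add_le _ _).trans_eq ?_
      rw [AbsoluteValue.map_neg]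
      rfl
    have ha := le_max_left (v α) 1
    have hb := le_max_left (v β) 1
    have ha' := le_max_right (v α) 1
    have hb' := le_max_right (v β) 1
    refine h1.trans ?_
    nlinarith
  -- The product formula for `π` makes its finite part the inverse of this infinite part, so
  -- closeness at finite places becomes a power of `p`.
  have hπinf : (∏ v : InfinitePlace E, v π ^ v.mult) ^ d = (p : ℝ) ^ finrank ℚ E := by
    rw [← InfinitePlace.sum_mult_eq, ← Finset.prod_pow_eq_pow_sum, ← Finset.prod_pow]
    refine Finset.prod_congr rfl fun v _ ↦ ?_
    rw [pow_right_comm, ← map_pow, hπ, InfinitePlace.map_natCast]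
  have hprodπ := prod_abs_eq_one hπ0
  have hprod := prod_abs_eq_one hsub
  set P := ∏ v : InfinitePlace E, v π ^ v.mult
  have hP : 0 < P := Finset.prod_pos fun v _ ↦ pow_pos (InfinitePlace.pos_iff.2 hπ0) _
  have hfin0 : 0 ≤ ∏ᶠ v : FinitePlace E, v (α - β) := finprod_nonneg fun v ↦ v.1.nonneg _
  have hmul := mul_le_mul hinf hfin hfin0 (by positivity)
  rw [hprod] at hmul
  rw [← hπinf]
  refine pow_le_pow_left₀ hP.le ?_ d
  rw [NumberField.mulHeight₁_eq, NumberField.mulHeight₁_eq]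
  calc P = P * 1 := (mul_one P).symm
    _ ≤ P * _ := mul_le_mul_of_nonneg_left hmul hP.le
    _ = (P * ∏ᶠ v : FinitePlace E, v π) * _ := by rw [mul_left_comm _ (finprod _), ← mul_assoc P]
    _ = _ := by rw [hprodπ, one_mul]; ring

theorem NumberField.pow_finrank_le_of_mem_adjoin_roots [IsGalois ℚ E] {r : ℕ → E}
    {p e : ℕ → ℕ} {n : ℕ} (he : ∀ i ≤ n, e i ≠ 0) (hr : ∀ i ≤ n, r i ^ e i = p i)
    (hpn : (p n).Prime) (hp : ∀ i < n, Nat.Coprime (p i) (p n))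
    (hep : ∀ i < n, Nat.Coprime (e i) (p n)) {α : E}
    (hα : α ∈ IntermediateField.adjoin ℚ (r '' Set.Iio (n + 1)))
    (hα' : α ∉ IntermediateField.adjoin ℚ (r '' Set.Iio n)) :
    (p n : ℝ) ^ finrank ℚ E ≤ (2 ^ finrank ℚ E * mulHeight₁ α ^ 2) ^ e n := by
  set K := IntermediateField.adjoin ℚ (r '' Set.Iio n) with hK
  have hα2 : α ∈ IntermediateField.adjoin K {r n} := by
    rwa [show Set.Iio (n + 1) = insert n (Set.Iio n) from Order.Iio_succ_eq_insert n,
      Set.image_insert_eq, Set.insert_eq, Set.union_comm,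
      ← IntermediateField.adjoin_adjoin_left] at hα
  obtain ⟨a, ha, hsum⟩ := K.exists_eq_sum_range_of_mem_adjoin (he n le_rfl)
    (by rw [hr n le_rfl]; exact natCast_mem _ _) hα2
  obtain ⟨σ, hσ, hσα⟩ : ∃ σ ∈ K.fixingSubgroup, σ α ≠ α := by
    by_contra! hall
    rw [← IsGalois.fixedField_fixingSubgroup K] at hα'
    exact hα' fun σ ↦ hall σ σ.2
  have hσsum : σ α = ∑ i ∈ Finset.range (e n), a i * σ (r n) ^ i := by
    conv_lhs => rw [hsum]
    rw [map_sum]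
    refine Finset.sum_congr rfl fun i _ ↦ ?_
    rw [map_mul, map_pow, (IntermediateField.mem_fixingSubgroup_iff K σ).1 hσ _ (ha i)]
  have hσH : mulHeight₁ (σ α) = mulHeight₁ α := mulHeight₁_ringEquiv σ.toRingEquiv α
  have hσr : σ (r n) ^ e n = p n := by rw [← map_pow, hr n le_rfl, map_natCast]
  have := pow_finrank_le_of_forall_sub_le hσα.symm hpn.ne_zero (he n le_rfl) (hr n le_rfl)
    fun v ↦ by
      have hv : IsNonarchimedean v.1 := FinitePlace.add_le v
      have hle : v.1 (p n : E) ≤ 1 := by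
        exact_mod_cast hv.apply_intCast_le_one (n := (p n : ℤ))
      -- Away from `p n` the root `r n` is a unit and the ultrametric inequality suffices; above `p
      -- n` total ramification is used.
      rcases hle.eq_or_lt with h1 | h1
      · have hπ1 : v (r n) = 1 := by
          rw [← hr n le_rfl, map_pow] at h1
          exact (pow_eq_one_iff_of_nonneg (v.1.nonneg _) (he n le_rfl)).1 h1
        rw [hπ1, one_mul, sub_eq_add_neg]
        refine (hv _ _).trans (max_le ?_ ?_)
        · exact (le_max_left _ 1).trans (le_mul_of_one_le_right (by positivity) (le_max_right _ _))
        · rw [AbsoluteValue.map_neg]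
          exact (le_max_left _ 1).trans (le_mul_of_one_le_left (by positivity) (le_max_right _ _))
      · have hU := v.1.isUniformizerOn_adjoin_roots hv hpn h1 (fun i hi ↦ he i hi.le)
          (fun i hi ↦ hr i hi.le) hp hep
        have := v.1.sub_le_of_isUniformizerOn hv hU (v.1.pos (by exact_mod_cast hpn.ne_zero)) h1
          (he n le_rfl) (hr n le_rfl) hσr (fun j _ ↦ ha j)
        rwa [← hsum, ← hσsum] at this
  rwa [hσH, ← sq] at this

end GaloisBound

/-! ### Absolute heights -/

section AbsoluteHeight

open NumberField Height Module

/-- The absolute height is defined through `ℚ(x)`; normalizing by the degree makes any number field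
containing `x` equally good. -/
theorem NumberField.mulHeight₁_eq_absMulHeight₁_pow {L : Type*} [Field L] [CharZero L]
    (E : IntermediateField ℚ L) [NumberField E] (x : E) :
    mulHeight₁ x = absMulHeight₁ (x : L) ^ finrank ℚ E := by
  have hx : IsIntegral ℚ (x : L) := (IsIntegral.of_finite ℚ x).map E.val
  have : FiniteDimensional ℚ (IntermediateField.adjoin ℚ {(x : L)}) :=
    IntermediateField.adjoin.finiteDimensional hx
  have : NumberField (IntermediateField.adjoin ℚ {(x : L)}) := {}
  have hle : IntermediateField.adjoin ℚ {(x : L)} ≤ E := by simp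
  have h := mulHeight₁_ringHom_pow_finrank (IntermediateField.inclusion hle).toRingHom
    (IntermediateField.AdjoinSimple.gen ℚ (x : L))
  have hx' : (IntermediateField.inclusion hle).toRingHom
      (IntermediateField.AdjoinSimple.gen ℚ (x : L)) = x := rfl
  rw [hx'] at h
  have hd : (finrank ℚ (IntermediateField.adjoin ℚ {(x : L)}) : ℝ) ≠ 0 := by
    exact_mod_cast finrank_pos.ne'
  rw [absMulHeight₁, dif_pos hx, ← Real.rpow_natCast, ← Real.rpow_mul (mulHeight₁_nonneg _),
    mul_comm, Real.rpow_mul (mulHeight₁_nonneg _), Real.rpow_natCast, ← h, ← Real.rpow_natCast,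
    ← Real.rpow_mul (mulHeight₁_nonneg _), mul_inv_cancel₀ hd, Real.rpow_one]

theorem NumberField.absMulHeight₁_nonneg {L : Type*} [Field L] [CharZero L] (x : L) :
    0 ≤ absMulHeight₁ x := by
  rw [absMulHeight₁]
  split_ifs with hx
  · have : FiniteDimensional ℚ (IntermediateField.adjoin ℚ {x}) :=
      IntermediateField.adjoin.finiteDimensional hx
    have : NumberField (IntermediateField.adjoin ℚ {x}) := {}
    exact Real.rpow_nonneg (mulHeight₁_nonneg _) _
  · exact zero_le_one

/-- A root of a natural number has the expected height. -/
theorem NumberField.absMulHeight₁_pow_of_pow_eq_natCast {L : Type*} [Field L] [CharZero L] {x : L}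
    {m n : ℕ} (hn : n ≠ 0) (hm : m ≠ 0) (hx : x ^ n = m) : absMulHeight₁ x ^ n = m := by
  have hint : IsIntegral ℚ x := ⟨Polynomial.X ^ n - Polynomial.C (m : ℚ),
    Polynomial.monic_X_pow_sub_C _ hn, by simp [hx]⟩
  have : FiniteDimensional ℚ (IntermediateField.adjoin ℚ {x}) :=
    IntermediateField.adjoin.finiteDimensional hint
  have : NumberField (IntermediateField.adjoin ℚ {x}) := {}
  set K := IntermediateField.adjoin ℚ {x}
  have hK := mulHeight₁_eq_absMulHeight₁_pow K (IntermediateField.AdjoinSimple.gen ℚ x)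
  rw [IntermediateField.AdjoinSimple.coe_gen] at hK
  have hpow : IntermediateField.AdjoinSimple.gen ℚ x ^ n = algebraMap ℚ K m :=
    Subtype.ext (by simp [hx])
  have : NeZero m := ⟨hm⟩
  have h2 : mulHeight₁ (algebraMap ℚ K m) = (m : ℝ) ^ finrank ℚ K := by
    have := mulHeight₁_algebraMap (E := K) (m : ℚ)
    rwa [Rat.mulHeight₁_natCast] at this
  rw [← hpow, mulHeight₁_pow, hK, pow_right_comm] at h2
  exact (pow_left_inj₀ (pow_nonneg (absMulHeight₁_nonneg _) _) (Nat.cast_nonneg _)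
    finrank_pos.ne').1 h2

end AbsoluteHeight

/-! ### A criterion for property (N) -/

section PropertyN

open NumberField Height Module

variable {L : Type*} [Field L] [CharZero L] [IsAlgClosure ℚ L]

theorem NumberField.finiteDimensional_adjoin_image_Iio (r : ℕ → L) (n : ℕ) :
    FiniteDimensional ℚ (IntermediateField.adjoin ℚ (r '' Set.Iio n)) := by
  have : Algebra.IsAlgebraic ℚ L := IsAlgClosure.isAlgebraic
  have : Finite (r '' Set.Iio n) := ((Set.finite_Iio n).image r).to_subtype
  exact IntermediateField.finiteDimensional_adjoin fun x _ ↦ Algebra.IsIntegral.isIntegral x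

/-- A new element in the `n`-th step of a tower of radical extensions has large height. -/
theorem NumberField.le_two_mul_absMulHeight₁_sq_pow {r : ℕ → L} {p e : ℕ → ℕ} {n : ℕ}
    (he : ∀ i ≤ n, e i ≠ 0) (hr : ∀ i ≤ n, r i ^ e i = p i) (hpn : (p n).Prime)
    (hp : ∀ i < n, Nat.Coprime (p i) (p n)) (hep : ∀ i < n, Nat.Coprime (e i) (p n)) {α : L}
    (hα : α ∈ IntermediateField.adjoin ℚ (r '' Set.Iio (n + 1)))
    (hα' : α ∉ IntermediateField.adjoin ℚ (r '' Set.Iio n)) :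
    (p n : ℝ) ≤ (2 * absMulHeight₁ α ^ 2) ^ e n := by
  classical
  have := finiteDimensional_adjoin_image_Iio r (n + 1)
  set M := IntermediateField.adjoin ℚ (r '' Set.Iio (n + 1)) with hM
  set E := IntermediateField.normalClosure ℚ M L with hE
  have hME : M ≤ E := IntermediateField.le_normalClosure M
  have : FiniteDimensional ℚ E := normalClosure.is_finiteDimensional ℚ M L
  have : Normal ℚ E := normalClosure.normal ℚ M L
  have : NumberField E := {}
  have : IsGalois ℚ E := {}
  have hrE (i : ℕ) (hi : i ≤ n) : r i ∈ E :=
    hME (IntermediateField.subset_adjoin _ _ ⟨i, Nat.lt_succ_of_le hi, rfl⟩)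
  -- The value 0 is a filler: only indices up to `n` matter, and their roots lie in `E`.
  let r' (i : ℕ) : E := if h : r i ∈ E then ⟨r i, h⟩ else 0
  have hr' (i : ℕ) (hi : i ≤ n) : (r' i : L) = r i := by simp [r', hrE i hi]
  have hmem (m : ℕ) (hm : m ≤ n + 1) (x : E) : x ∈ IntermediateField.adjoin ℚ (r' '' Set.Iio m) ↔
      (x : L) ∈ IntermediateField.adjoin ℚ (r '' Set.Iio m) := by
    have himg : r '' Set.Iio m = E.val '' (r' '' Set.Iio m) := by
      rw [Set.image_image]
      refine Set.image_congr fun i hi ↦ ?_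
      rw [Set.mem_Iio] at hi
      exact (hr' i (by omega)).symm
    rw [himg, ← IntermediateField.adjoin_map, IntermediateField.mem_map]
    refine ⟨fun h ↦ ⟨x, h, rfl⟩, ?_⟩
    rintro ⟨y, hy, hyx⟩
    rwa [← Subtype.ext hyx]
  have key := pow_finrank_le_of_mem_adjoin_roots (α := ⟨α, hME hα⟩) he
    (fun i hi ↦ Subtype.ext (by simp [hr' i hi, hr i hi])) hpn hp hep
    ((hmem _ le_rfl _).2 hα) (fun h ↦ hα' ((hmem _ n.le_succ _).1 h))
  rw [mulHeight₁_eq_absMulHeight₁_pow E, pow_right_comm, ← mul_pow, pow_right_comm] at key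
  have h0 : (0 : ℝ) ≤ (2 * absMulHeight₁ α ^ 2) ^ e n := by positivity
  exact (pow_le_pow_iff_left₀ (Nat.cast_nonneg _) h0 finrank_pos.ne').1 key

theorem IntermediateField.exists_mem_adjoin_image_Iio {F : Type*} [Field F] {L : Type*} [Field L]
    [Algebra F L] {r : ℕ → L} {x : L}
    (hx : x ∈ IntermediateField.adjoin F (Set.range r)) :
    ∃ n, x ∈ IntermediateField.adjoin F (r '' Set.Iio n) := by
  classical
  obtain ⟨T, hT, hxT⟩ := IntermediateField.exists_finset_of_mem_adjoin hx
  obtain ⟨s, rfl⟩ : ∃ s : Finset ℕ, s.image r = T := by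
    rw [← Set.image_univ] at hT
    obtain ⟨s, -, hs⟩ := Finset.subset_set_image_iff.1 hT
    exact ⟨s, hs⟩
  refine ⟨s.sup id + 1, IntermediateField.adjoin.mono F _ _ ?_ hxT⟩
  rw [Finset.coe_image]
  exact Set.image_mono fun i hi ↦ Nat.lt_succ_of_le (Finset.le_sup (f := id) hi)

/-- Widmer-type criterion: fields generated by roots of primes have property (N) as soon as the
roots tend to infinity. -/
theorem NumberField.finite_absMulHeight₁_le_adjoin_roots {r : ℕ → L} {p e : ℕ → ℕ}
    (he : ∀ i, e i ≠ 0) (hr : ∀ i, r i ^ e i = p i) (hp : ∀ i, (p i).Prime)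
    (hpp : ∀ i j, i < j → Nat.Coprime (p i) (p j)) (hep : ∀ i j, i < j → Nat.Coprime (e i) (p j))
    (hgrow : ∀ B : ℝ, 1 ≤ B → ∃ N, ∀ n ≥ N, B ^ e n < p n) (X : ℝ) :
    {α ∈ (IntermediateField.adjoin ℚ (Set.range r) : Set L) | absMulHeight₁ α ≤ X}.Finite := by
  obtain ⟨N, hN⟩ := hgrow (max (2 * X ^ 2) 1) (le_max_right _ _)
  have := finiteDimensional_adjoin_image_Iio r N
  set K := IntermediateField.adjoin ℚ (r '' Set.Iio N) with hK
  have : NumberField K := {}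
  refine ((finite_setOfPred_mulHeight₁_le K (X ^ finrank ℚ K)).image Subtype.val).subset ?_
  rintro α ⟨hα, hX⟩
  have hαK : α ∈ K := by
    classical
    have hex := IntermediateField.exists_mem_adjoin_image_Iio hα
    by_contra hnot
    -- At the first step of the tower containing it, `α` is new, so the height bound applies.
    have hlt : N < Nat.find hex := by
      by_contra! hle
      exact hnot (IntermediateField.adjoin.mono ℚ _ _
        (Set.image_mono (Set.Iio_subset_Iio hle)) (Nat.find_spec hex))
    obtain ⟨m, hm⟩ : ∃ m, Nat.find hex = m + 1 := ⟨Nat.find hex - 1, by omega⟩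
    have h1 := Nat.find_spec hex
    rw [hm] at h1
    have h2 := Nat.find_min hex (m := m) (by omega)
    have h3 := le_two_mul_absMulHeight₁_sq_pow (fun i _ ↦ he i) (fun i _ ↦ hr i) (hp m)
      (fun i hi ↦ hpp i m hi) (fun i hi ↦ hep i m hi) h1 h2
    have h4 := hN m (by omega)
    have h5 : (2 * absMulHeight₁ α ^ 2) ^ e m ≤ (max (2 * X ^ 2) 1) ^ e m := by
      refine pow_le_pow_left₀ (by positivity) (le_max_of_le_left ?_) _
      have := absMulHeight₁_nonneg α
      gcongr
    linarith
  refine ⟨⟨α, hαK⟩, ?_, rfl⟩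
  change mulHeight₁ (⟨α, hαK⟩ : K) ≤ _
  rw [mulHeight₁_eq_absMulHeight₁_pow K]
  exact pow_le_pow_left₀ (absMulHeight₁_nonneg _) hX _

end PropertyN

/-! ### The two fields and their compositum -/

section RadicalFields

open NumberField Filter

theorem posRoot_pow (a : ℕ) {b : ℕ} (hb : b ≠ 0) : posRoot a b ^ b = a := by
  apply Subtype.ext
  change ((((a : ℝ) ^ (1 / (b : ℝ)) : ℝ) : ℂ)) ^ b = ((a : QBar) : ℂ)
  rw [← Complex.ofReal_pow, one_div, Real.rpow_inv_natCast_pow (Nat.cast_nonneg a) hb]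
  simp

theorem primeSeq_prime (i : ℕ) : (primeSeq i).Prime := Nat.prime_nth_prime i

theorem primeSeq_strictMono : StrictMono primeSeq := Nat.nth_strictMono Nat.infinite_setOfPred_prime

theorem three_le_primeSeq_succ (i : ℕ) : 3 ≤ primeSeq (i + 1) := by
  have h0 := (primeSeq_prime 0).two_le
  have := primeSeq_strictMono (Nat.zero_lt_succ i)
  rw [Nat.succ_eq_add_one] at this
  omega

/-- Holds because `e < 3 ≤ p`. The shift omits `p = 2`, where `log 2 < 1` would give degree 0. -/
theorem one_le_degSeq_succ (i : ℕ) : 1 ≤ degSeq (i + 1) := by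
  rw [degSeq, Nat.one_le_floor_iff, Real.one_le_sqrt, Real.le_log_iff_exp_le]
  · have h3 : (3 : ℝ) ≤ primeSeq (i + 1) := by exact_mod_cast three_le_primeSeq_succ i
    linarith [Real.exp_one_lt_d9]
  · exact_mod_cast (primeSeq_prime _).pos

theorem degSeq_succ_ne_zero (i : ℕ) : degSeq (i + 1) ≠ 0 :=
  Nat.one_le_iff_ne_zero.1 (one_le_degSeq_succ i)

theorem degSeq_le_sqrt (i : ℕ) : (degSeq i : ℝ) ≤ √(Real.log (primeSeq i)) :=
  Nat.floor_le (Real.sqrt_nonneg _)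

theorem log_primeSeq_lt (i : ℕ) : Real.log (primeSeq i) < (degSeq i + 1 : ℝ) ^ 2 := by
  rw [← Real.sqrt_lt' (by positivity)]
  exact Nat.lt_floor_add_one _

/-- Keeps every exponent coprime to all later primes, as the ramification argument requires. -/
theorem degSeq_add_one_lt (i : ℕ) : degSeq (i + 1) + 1 < primeSeq (i + 1) := by
  have h3 : (3 : ℝ) ≤ primeSeq (i + 1) := by exact_mod_cast three_le_primeSeq_succ i
  have hlog := Real.log_lt_sub_one_of_pos (x := primeSeq (i + 1)) (by linarith) (by linarith)
  have hsqrt : √(Real.log (primeSeq (i + 1))) < primeSeq (i + 1) - 1 := by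
    rw [Real.sqrt_lt' (by linarith)]
    nlinarith
  have := degSeq_le_sqrt (i + 1)
  have h : (degSeq (i + 1) + 1 : ℝ) < primeSeq (i + 1) := by linarith
  exact_mod_cast h

theorem tendsto_sqrt_log_primeSeq :
    Tendsto (fun i ↦ √(Real.log (primeSeq (i + 1)))) atTop atTop :=
  Real.tendsto_sqrt_atTop.comp <| Real.tendsto_log_atTop.comp <|
    tendsto_natCast_atTop_atTop.comp <|
      primeSeq_strictMono.tendsto_atTop.comp (tendsto_add_atTop_nat 1)

/-- Degrees of size at most `√(log p) + 1` are small enough for property (N). -/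
theorem hasPropertyN_adjoin_posRoot {e : ℕ → ℕ} (he : ∀ i, e (i + 1) ≠ 0)
    (hle : ∀ i, e (i + 1) ≤ degSeq (i + 1) + 1) :
    HasPropertyN (IntermediateField.adjoin ℚ
      {x | ∃ i : ℕ, 1 ≤ i ∧ x = posRoot (primeSeq i) (e i)} : IntermediateField ℚ QBar) := by
  have : IsAlgClosure ℚ QBar := algebraicClosure.isAlgClosure ℚ ℂ
  have hset : {x | ∃ i : ℕ, 1 ≤ i ∧ x = posRoot (primeSeq i) (e i)} =
      Set.range fun i ↦ posRoot (primeSeq (i + 1)) (e (i + 1)) := by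
    ext x
    constructor
    · rintro ⟨i, hi, rfl⟩
      exact ⟨i - 1, by simp [Nat.sub_add_cancel hi]⟩
    · rintro ⟨i, rfl⟩
      exact ⟨i + 1, by omega, rfl⟩
  rw [hset]
  intro X _
  refine finite_absMulHeight₁_le_adjoin_roots (L := QBar) (p := fun i ↦ primeSeq (i + 1))
    (e := fun i ↦ e (i + 1)) he (fun i ↦ posRoot_pow _ (he i)) (fun i ↦ primeSeq_prime _)
    (fun i j hij ↦ ?_) (fun i j hij ↦ ?_) (fun B hB ↦ ?_) X
  · exact (Nat.coprime_primes (primeSeq_prime _) (primeSeq_prime _)).2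
      (primeSeq_strictMono (by omega)).ne
  · refine ((primeSeq_prime _).coprime_iff_not_dvd.2 fun hdvd ↦ ?_).symm
    have h1 := Nat.le_of_dvd (Nat.pos_of_ne_zero (he i)) hdvd
    have h2 : primeSeq (i + 1) < primeSeq (j + 1) := primeSeq_strictMono (by omega)
    have h3 := degSeq_add_one_lt i
    have h4 := hle i
    omega
  -- With `s = √(log p)` and `s > log B + 1`, one gets `e * log B ≤ (s + 1) * log B < s ^ 2 = log
  -- p`.
  · obtain ⟨N, hN⟩ := eventually_atTop.1
      (tendsto_sqrt_log_primeSeq.eventually_gt_atTop (Real.log B + 1))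
    refine ⟨N, fun n hn ↦ ?_⟩
    have hs := hN n hn
    have hlogB : 0 ≤ Real.log B := Real.log_nonneg hB
    have hp : (0 : ℝ) < primeSeq (n + 1) := by exact_mod_cast (primeSeq_prime _).pos
    have hlp : 0 ≤ Real.log (primeSeq (n + 1)) :=
      Real.log_nonneg (by exact_mod_cast (primeSeq_prime _).one_le)
    have hsq := Real.sq_sqrt hlp
    have hen : (e (n + 1) : ℝ) ≤ √(Real.log (primeSeq (n + 1))) + 1 := by
      have h1 : (e (n + 1) : ℝ) ≤ degSeq (n + 1) + 1 := by exact_mod_cast hle n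
      linarith [degSeq_le_sqrt (n + 1)]
    rw [← Real.log_lt_log_iff (by positivity) hp, Real.log_pow, ← hsq]
    have := mul_le_mul_of_nonneg_right hen hlogB
    nlinarith

theorem hasPropertyN_fieldL₁ : HasPropertyN (fieldL₁ : Set QBar) :=
  hasPropertyN_adjoin_posRoot (e := degSeq) degSeq_succ_ne_zero
    fun _ ↦ Nat.le_succ _

theorem hasPropertyN_fieldL₂ : HasPropertyN (fieldL₂ : Set QBar) :=
  hasPropertyN_adjoin_posRoot (e := fun i ↦ degSeq i + 1) (fun _ ↦ Nat.succ_ne_zero _)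
    fun _ ↦ le_rfl

/-- The quotient of two consecutive roots, a root of order `d (d + 1)`, where
`d = degSeq (i + 1)`. -/
noncomputable def rootQuotient (i : ℕ) : QBar :=
  posRoot (primeSeq (i + 1)) (degSeq (i + 1)) / posRoot (primeSeq (i + 1)) (degSeq (i + 1) + 1)

theorem rootQuotient_mem (i : ℕ) : rootQuotient i ∈ fieldL₁ ⊔ fieldL₂ := by
  have h1 : posRoot (primeSeq (i + 1)) (degSeq (i + 1)) ∈ fieldL₁ :=
    IntermediateField.subset_adjoin _ _ ⟨i + 1, by omega, rfl⟩
  have h2 : posRoot (primeSeq (i + 1)) (degSeq (i + 1) + 1) ∈ fieldL₂ :=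
    IntermediateField.subset_adjoin _ _ ⟨i + 1, by omega, rfl⟩
  exact div_mem ((le_sup_left : fieldL₁ ≤ fieldL₁ ⊔ fieldL₂) h1)
    ((le_sup_right : fieldL₂ ≤ fieldL₁ ⊔ fieldL₂) h2)

theorem rootQuotient_pow (i : ℕ) :
    rootQuotient i ^ (degSeq (i + 1) * (degSeq (i + 1) + 1)) = primeSeq (i + 1) := by
  have hp : (primeSeq (i + 1) : QBar) ≠ 0 := by exact_mod_cast (primeSeq_prime _).ne_zero
  rw [rootQuotient, div_pow, pow_mul, posRoot_pow _ (degSeq_succ_ne_zero i),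
    mul_comm (degSeq (i + 1)),
    pow_mul (posRoot _ (degSeq (i + 1) + 1)), posRoot_pow _ (Nat.succ_ne_zero _), pow_succ,
    mul_div_cancel_left₀ _ (pow_ne_zero _ hp)]

/-- Equal quotients would make positive powers of two of the primes equal. -/
theorem rootQuotient_injective : Function.Injective rootQuotient := by
  intro i j hij
  have hi := rootQuotient_pow i
  have hj := rootQuotient_pow j
  rw [← hij] at hj
  set m := degSeq (i + 1) * (degSeq (i + 1) + 1)
  set n := degSeq (j + 1) * (degSeq (j + 1) + 1) with hn
  have h : primeSeq (i + 1) ^ n = primeSeq (j + 1) ^ m := by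
    have : (primeSeq (i + 1) : QBar) ^ n = primeSeq (j + 1) ^ m := by
      rw [← hi, ← hj, pow_right_comm]
    exact_mod_cast this
  have hn0 : n ≠ 0 := mul_ne_zero (degSeq_succ_ne_zero j) (Nat.succ_ne_zero _)
  have hdvd : primeSeq (i + 1) ∣ primeSeq (j + 1) :=
    (primeSeq_prime _).dvd_of_dvd_pow (h ▸ dvd_pow_self _ hn0)
  have := primeSeq_strictMono.injective
    ((Nat.prime_dvd_prime_iff_eq (primeSeq_prime _) (primeSeq_prime _)).1 hdvd)
  omega

/-- The constant comes from `log p < (d + 1) ^ 2 ≤ 2 * d * (d + 1)`, valid since `d ≥ 1`. -/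
theorem absMulHeight₁_rootQuotient_le (i : ℕ) : absMulHeight₁ (rootQuotient i) ≤ Real.exp 2 := by
  have hd := one_le_degSeq_succ i
  have hm0 : degSeq (i + 1) * (degSeq (i + 1) + 1) ≠ 0 :=
    mul_ne_zero (degSeq_succ_ne_zero i) (Nat.succ_ne_zero _)
  have h := absMulHeight₁_pow_of_pow_eq_natCast hm0 (primeSeq_prime (i + 1)).ne_zero
    (rootQuotient_pow i)
  rw [← pow_le_pow_iff_left₀ (absMulHeight₁_nonneg _) (Real.exp_pos _).le hm0, h,
    ← Real.exp_nat_mul, ← Real.log_le_iff_le_exp (by exact_mod_cast (primeSeq_prime _).pos)]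
  have hlog := log_primeSeq_lt (i + 1)
  have hd' : (1 : ℝ) ≤ degSeq (i + 1) := by exact_mod_cast hd
  push_cast
  nlinarith

theorem not_hasPropertyN_sup :
    ¬ HasPropertyN ((fieldL₁ ⊔ fieldL₂ : IntermediateField ℚ QBar) : Set QBar) := fun h ↦
  Set.infinite_of_injective_forall_mem
    (s := {α ∈ ((fieldL₁ ⊔ fieldL₂ : IntermediateField ℚ QBar) : Set QBar) |
      absMulHeight₁ α ≤ Real.exp 2}) rootQuotient_injective
    (fun i ↦ ⟨rootQuotient_mem i, absMulHeight₁_rootQuotient_le i⟩) (h _ (Real.exp_pos 2))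

end RadicalFields

theorem theorem1p6 :
    (¬ ∀ L M : IntermediateField ℚ QBar,
        HasPropertyN (L : Set QBar) → HasPropertyN (M : Set QBar) →
          HasPropertyN ((L ⊔ M : IntermediateField ℚ QBar) : Set QBar)) ∧
    HasPropertyN (fieldL₁ : Set QBar) ∧
    HasPropertyN (fieldL₂ : Set QBar) ∧
    ¬ HasPropertyN ((fieldL₁ ⊔ fieldL₂ : IntermediateField ℚ QBar) : Set QBar) :=
  ⟨fun h ↦ not_hasPropertyN_sup (h _ _ hasPropertyN_fieldL₁ hasPropertyN_fieldL₂),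
    hasPropertyN_fieldL₁, hasPropertyN_fieldL₂, not_hasPropertyN_sup⟩
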